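/- Let $X$ be a reflexive (real or complex) Banach space such that the closed unit balls of $X$ and of its dual $X'$ are strictly convex. Let $G$ be a (nonempty) semitopological semigroup, i.e. a semigroup with a topology for which multiplication is separately continuous, and let $\mathcal S=\{S_g : g\in G\}$ be a representation of $G$ on $X$ by contractions: each $S_g$ is a bounded linear operator on $X$ with $\|S_g\|\le 1$, $S_gS_h=S_{hg}$ for all $g,h\in G$, and $g\mapsto S_gx$ is continuous for every $x\in X$. Then $\mathcal S$ is mean ergodic, that is, the closure $\overline{\mathrm{co}}\,\mathcal S$ of the convex hull of $\mathcal S$ in the strong operator topology contains a zero element: there is $P\in\overline{\mathrm{co}}\,\mathcal S$ with $PT=TP=P$ for all $T\in\overline{\mathrm{co}}\,\mathcal S$. -/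

import Mathlib

/-- A bounded representation `g ↦ S_g` of a semitopological semigroup `G` (i.e. the multiplication
is separately continuous) on a Banach space `X`: a uniformly bounded family of bounded linear
operators with `S_g S_h = S_{hg}` such that `g ↦ S_g x` is continuous for all `x`. -/
structure BoundedRepresentation (𝕜 : Type*) [RCLike 𝕜] (G : Type*) [Semigroup G]
    [TopologicalSpace G] [SeparatelyContinuousMul G] (X : Type*) [NormedAddCommGroup X]
    [NormedSpace 𝕜 X] where
  /-- The operator `S_g`. -/
  toFun : G → (X →L[𝕜] X)
  bounded' : ∃ C : ℝ, ∀ g, ‖toFun g‖ ≤ C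
  comp' : ∀ g h, (toFun g).comp (toFun h) = toFun (h * g)
  continuous' : ∀ x, Continuous fun g => toFun g x

/-- The operator semigroup `𝒮 = {S_g : g ∈ G}`. -/
def BoundedRepresentation.operators {𝕜 : Type*} [RCLike 𝕜] {G : Type*} [Semigroup G]
    [TopologicalSpace G] [SeparatelyContinuousMul G] {X : Type*} [NormedAddCommGroup X]
    [NormedSpace 𝕜 X] (S : BoundedRepresentation 𝕜 G X) : Set (X →L[𝕜] X) :=
  Set.range S.toFun

/-- A normed space is reflexive if the canonical map into its bidual is surjective. -/
def IsReflexiveSpace (𝕜 : Type*) [RCLike 𝕜] (X : Type*) [NormedAddCommGroup X]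
    [NormedSpace 𝕜 X] : Prop :=
  Function.Surjective (NormedSpace.inclusionInDoubleDual 𝕜 X)

/-- The closure of the (real) convex hull of a set of operators with respect to the strong
operator topology, that is, the topology of pointwise convergence on `X` carried by the type
synonym `X →Lₚₜ[𝕜] X` of `X →L[𝕜] X`. -/
def strongClosedConvexHull {𝕜 : Type*} [RCLike 𝕜] {X : Type*} [NormedAddCommGroup X]
    [NormedSpace 𝕜 X] [NormedSpace ℝ X] [IsScalarTower ℝ 𝕜 X] (𝒮 : Set (X →L[𝕜] X)) :
    Set (X →L[𝕜] X) :=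
  UniformConvergenceCLM.ofFun (RingHom.id 𝕜) X {s : Set X | Finite s} ⁻¹'
    (closure (X := X →Lₚₜ[𝕜] X)
      (UniformConvergenceCLM.ofFun (RingHom.id 𝕜) X {s : Set X | Finite s} '' convexHull ℝ 𝒮))

/-- `P` is a zero element of the set `𝒯` of operators (under composition). -/
def IsZeroElementOf {𝕜 : Type*} [RCLike 𝕜] {X : Type*} [NormedAddCommGroup X]
    [NormedSpace 𝕜 X] (𝒯 : Set (X →L[𝕜] X)) (P : X →L[𝕜] X) : Prop :=
  P ∈ 𝒯 ∧ ∀ T ∈ 𝒯, P.comp T = P ∧ T.comp P = P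

/-- A semigroup of operators is mean ergodic if the closure of its convex hull in the strong
operator topology contains a zero element. -/
def IsMeanErgodic {𝕜 : Type*} [RCLike 𝕜] {X : Type*} [NormedAddCommGroup X]
    [NormedSpace 𝕜 X] [NormedSpace ℝ X] [IsScalarTower ℝ 𝕜 X] (𝒮 : Set (X →L[𝕜] X)) : Prop :=
  ∃ P : X →L[𝕜] X, IsZeroElementOf (strongClosedConvexHull 𝒮) P

open Set Metric NormedSpace

section StrictlyConvex

variable {E : Type*} [NormedAddCommGroup E] [NormedSpace ℝ E]

/-! The engine is one fixed point principle: the unique point of minimal norm in a convex set is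
fixed by every contraction preserving the set. It is used twice. In `X` with the weak topology it
yields a fixed point `p x` in the closed convex hull of each orbit. In the dual with the weak-*
topology it extends the restriction of any functional to the fixed space to an invariant functional.
Hence invariant functionals separate fixed points; as they agree on `x` and `p x`, they determine `p
x`. So `p` is linear and constant on orbits, and it is the desired zero element. -/

/-- In a strictly convex space, a point of minimal norm in a convex set is unique. -/
theorem eq_of_isMinOn_norm_of_norm_le [StrictConvexSpace ℝ E] {C : Set E} (hC : Convex ℝ C)
    {u v : E} (hu : u ∈ C) (hv : v ∈ C) (hmin : ∀ w ∈ C, ‖u‖ ≤ ‖w‖) (hvu : ‖v‖ ≤ ‖u‖) :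
    v = u := by
  by_contra hne
  have h := norm_combo_lt_of_ne hvu le_rfl hne (by norm_num : (0 : ℝ) < 1 / 2)
    (by norm_num : (0 : ℝ) < 1 / 2) (by norm_num)
  exact h.not_ge (hmin _ (hC hv hu (by norm_num) (by norm_num) (by norm_num)))

/-- If closed balls are compact for an auxiliary Hausdorff topology on a strictly convex space, then
a nonempty convex set that is closed for that topology contains a point fixed by all
contractions which leave the set invariant. -/
theorem exists_forall_fixed_of_isCompact_closedBall [StrictConvexSpace ℝ E] {W : Type*}
    [TopologicalSpace W] [T2Space W] (e : E ≃ W)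
    (hball : ∀ r : ℝ, IsCompact (e.symm ⁻¹' closedBall 0 r)) {C : Set E} (hC : Convex ℝ C)
    (hne : C.Nonempty) (hclosed : IsClosed (e.symm ⁻¹' C)) :
    ∃ u ∈ C, ∀ f : E → E, MapsTo f C C → (∀ x, ‖f x‖ ≤ ‖x‖) → f u = u := by
  obtain ⟨x₀, hx₀⟩ := hne
  -- Sublevel sets of the norm are balls, compact and hence closed in the Hausdorff space `W`.
  have hlsc : LowerSemicontinuous fun w : W => ‖e.symm w‖ := by
    rw [lowerSemicontinuous_iff_isClosed_preimage]
    intro r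
    convert (hball r).isClosed using 1
    ext w
    simp
  have hK : IsCompact (e.symm ⁻¹' C ∩ e.symm ⁻¹' closedBall 0 ‖x₀‖) :=
    (hball _).inter_left hclosed
  obtain ⟨w, ⟨hwC, hwb⟩, hmin⟩ := LowerSemicontinuousOn.exists_isMinOn
    (⟨e x₀, by simp [hx₀]⟩ : (e.symm ⁻¹' C ∩ e.symm ⁻¹' closedBall 0 ‖x₀‖).Nonempty) hK
    (hlsc.lowerSemicontinuousOn _)
  have hmin' : ∀ v ∈ C, ‖e.symm w‖ ≤ ‖v‖ := by
    intro v hv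
    rcases le_total ‖v‖ ‖x₀‖ with h | h
    · simpa using hmin (show e v ∈ _ from ⟨by simpa using hv, by simpa using h⟩)
    · exact (by simpa using hwb : ‖e.symm w‖ ≤ ‖x₀‖).trans h
  exact ⟨e.symm w, hwC, fun f hf hfn =>
    eq_of_isMinOn_norm_of_norm_le hC hwC (hf hwC) hmin' (hfn _)⟩

end StrictlyConvex

section WeakCompactness

variable {𝕜 : Type*} [RCLike 𝕜] {X : Type*} [NormedAddCommGroup X] [NormedSpace 𝕜 X]

/-- Closed balls of a reflexive space are weakly compact. -/
theorem IsReflexiveSpace.isCompact_toWeakSpace_closedBall (hrefl : IsReflexiveSpace 𝕜 X)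
    [NormedSpace ℝ X] [IsScalarTower ℝ 𝕜 X] (r : ℝ) :
    IsCompact ((toWeakSpace 𝕜 X).symm ⁻¹' closedBall (0 : X) r) := by
  have hclosed : IsClosed ((toWeakSpace 𝕜 X).symm ⁻¹' closedBall (0 : X) r) := by
    -- Mazur: for convex sets, norm closure and weak closure coincide.
    have h := (convex_closedBall (0 : X) r).toWeakSpace_closure (𝕜 := 𝕜)
    rw [isClosed_closedBall.closure_eq] at h
    have himage : toWeakSpace 𝕜 X '' closedBall (0 : X) r =
        (toWeakSpace 𝕜 X).symm ⁻¹' closedBall (0 : X) r :=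
      (toWeakSpace 𝕜 X).toEquiv.image_eq_preimage_symm _
    rw [himage] at h
    exact closure_eq_iff_isClosed.1 h.symm
  rw [← hclosed.closure_eq]
  refine isCompact_closure_of_isBounded 𝕜 X _ ?_ ?_
  · exact isBounded_closedBall
  · intro φ _
    obtain ⟨x, hx⟩ := hrefl (WeakDual.toStrongDual φ)
    exact ⟨toWeakSpace 𝕜 X x, congrArg StrongDual.toWeakDual hx⟩

instance : T2Space (WeakSpace 𝕜 X) :=
  (isEmbedding_inclusionInDoubleDualWeak 𝕜 X).t2Space

/-- Every functional agrees on the fixed space of a semigroup of contractions with an invariant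
functional. -/
theorem exists_invariant_dual_eqOn_fixed {𝒮 : Set (X →L[𝕜] X)}
    (hX' : StrictConvex ℝ (closedBall (0 : StrongDual 𝕜 X) 1)) (hS : ∀ A ∈ 𝒮, ‖A‖ ≤ 1)
    (φ : StrongDual 𝕜 X) :
    ∃ ψ : StrongDual 𝕜 X, (∀ A ∈ 𝒮, ψ.comp A = ψ) ∧ ∀ u, (∀ A ∈ 𝒮, A u = u) → ψ u = φ u := by
  have : StrictConvexSpace ℝ (StrongDual 𝕜 X) := .of_strictConvex_unitClosedBall ℝ hX'
  -- Precomposition with `A ∈ 𝒮` preserves `C` because `A` does not move the points `u` tested.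
  let C : Set (StrongDual 𝕜 X) := {ψ | ∀ u, (∀ A ∈ 𝒮, A u = u) → ψ u = φ u}
  have hC : Convex ℝ C := by
    intro ψ hψ ψ' hψ' a b _ _ hab u hu
    simp [hψ u hu, hψ' u hu, ← add_smul, hab]
  have hclosed : IsClosed ((StrongDual.toWeakDual (𝕜 := 𝕜) (E := X)).toEquiv.symm ⁻¹' C) := by
    have h : (StrongDual.toWeakDual (𝕜 := 𝕜) (E := X)).toEquiv.symm ⁻¹' C =
        ⋂ (u : X) (_ : ∀ A ∈ 𝒮, A u = u), {ψ : WeakDual 𝕜 X | ψ u = φ u} := by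
      ext ψ
      simp only [mem_iInter]
      rfl
    rw [h]
    exact isClosed_iInter fun u => isClosed_iInter fun _ =>
      isClosed_eq (WeakDual.eval_continuous u) continuous_const
  obtain ⟨ψ, hψ, hfix⟩ := exists_forall_fixed_of_isCompact_closedBall
    (StrongDual.toWeakDual (𝕜 := 𝕜) (E := X)).toEquiv
    (fun r => WeakDual.isCompact_closedBall 0 r) hC ⟨φ, fun _ _ => rfl⟩ hclosed
  refine ⟨ψ, fun A hA => hfix (fun χ => χ.comp A) ?_ ?_, hψ⟩
  · intro χ hχ u hu
    simpa [hu A hA] using hχ u hu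
  · intro χ
    exact (χ.opNorm_comp_le A).trans (mul_le_of_le_one_right (norm_nonneg _) (hS A hA))

end WeakCompactness

section Operators

variable {𝕜 : Type*} [RCLike 𝕜] {X : Type*} [NormedAddCommGroup X] [NormedSpace 𝕜 X]
  [NormedSpace ℝ X] [IsScalarTower ℝ 𝕜 X] {𝒮 : Set (X →L[𝕜] X)}

theorem norm_apply_le_of_mem_convexHull (hS : ∀ A ∈ 𝒮, ‖A‖ ≤ 1) {T : X →L[𝕜] X}
    (hT : T ∈ convexHull ℝ 𝒮) (x : X) : ‖T x‖ ≤ ‖x‖ := by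
  have h : T ∈ closedBall (0 : X →L[𝕜] X) 1 :=
    convexHull_min (fun A hA => by simpa using hS A hA) (convex_closedBall _ _) hT
  exact T.le_of_opNorm_le (by simpa using h) x |>.trans (one_mul _).le

/-- Composition is affine in each factor separately, so the hull is taken in one factor at a time.
-/
theorem comp_mem_convexHull (hmul : ∀ A ∈ 𝒮, ∀ B ∈ 𝒮, A.comp B ∈ 𝒮) {T U : X →L[𝕜] X}
    (hT : T ∈ convexHull ℝ 𝒮) (hU : U ∈ convexHull ℝ 𝒮) : T.comp U ∈ convexHull ℝ 𝒮 := by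
  have hleft : 𝒮 ⊆ {V | V.comp U ∈ convexHull ℝ 𝒮} := by
    intro A hA
    refine convexHull_min (t := {V | A.comp V ∈ convexHull ℝ 𝒮})
      (fun B hB => subset_convexHull ℝ 𝒮 (hmul A hA B hB)) ?_ hU
    intro V hV V' hV' a b ha hb hab
    have h : A.comp (a • V + b • V') = a • A.comp V + b • A.comp V' := by
      ext x
      simp
    simpa only [mem_ofPred_eq, h] using convex_convexHull ℝ 𝒮 hV hV' ha hb hab
  refine convexHull_min (t := {V | V.comp U ∈ convexHull ℝ 𝒮}) hleft ?_ hT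
  intro V hV V' hV' a b ha hb hab
  have h : (a • V + b • V').comp U = a • V.comp U + b • V'.comp U := by
    ext x
    simp
  simpa only [mem_ofPred_eq, h] using convex_convexHull ℝ 𝒮 hV hV' ha hb hab

theorem apply_eq_self_of_mem_convexHull {u : X} (hu : ∀ A ∈ 𝒮, A u = u) {T : X →L[𝕜] X}
    (hT : T ∈ convexHull ℝ 𝒮) : T u = u := by
  refine convexHull_min (t := {V : X →L[𝕜] X | V u = u}) hu ?_ hT
  intro V hV V' hV' a b _ _ hab
  simp only [mem_ofPred_eq] at hV hV' ⊢
  simp [hV, hV', ← add_smul, hab]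

theorem dual_apply_eq_of_mem_convexHull {φ : StrongDual 𝕜 X} (hφ : ∀ A ∈ 𝒮, φ.comp A = φ)
    {T : X →L[𝕜] X} (hT : T ∈ convexHull ℝ 𝒮) (x : X) : φ (T x) = φ x := by
  refine convexHull_min (t := {V : X →L[𝕜] X | φ (V x) = φ x})
    (fun A hA => DFunLike.congr_fun (hφ A hA) x) ?_ hT
  intro V hV V' hV' a b _ _ hab
  simp only [mem_ofPred_eq] at hV hV' ⊢
  simp [hV, hV', ContinuousLinearMap.map_smul_of_tower, ← add_smul, hab]

/-- The closed convex hull of every orbit of a semigroup of contractions on a strictly convex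
reflexive space contains a common fixed point. -/
theorem exists_fixed_mem_closure_orbit (hrefl : IsReflexiveSpace 𝕜 X)
    (hX : StrictConvex ℝ (closedBall (0 : X) 1)) (hne : 𝒮.Nonempty)
    (hmul : ∀ A ∈ 𝒮, ∀ B ∈ 𝒮, A.comp B ∈ 𝒮) (hS : ∀ A ∈ 𝒮, ‖A‖ ≤ 1) (x : X) :
    ∃ u ∈ closure ((fun T : X →L[𝕜] X => T x) '' convexHull ℝ 𝒮), ∀ A ∈ 𝒮, A u = u := by
  have : StrictConvexSpace ℝ X := .of_strictConvex_unitClosedBall ℝ hX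
  have hconv : Convex ℝ ((fun T : X →L[𝕜] X => T x) '' convexHull ℝ 𝒮) :=
    (convex_convexHull ℝ 𝒮).is_linear_image ⟨fun _ _ => rfl, fun _ _ => rfl⟩
  have hclosed : IsClosed ((toWeakSpace 𝕜 X).toEquiv.symm ⁻¹'
      closure ((fun T : X →L[𝕜] X => T x) '' convexHull ℝ 𝒮)) := by
    rw [← Equiv.image_eq_preimage_symm]
    have h := hconv.toWeakSpace_closure (𝕜 := 𝕜)
    exact h ▸ isClosed_closure
  obtain ⟨u, hu, hfix⟩ := exists_forall_fixed_of_isCompact_closedBall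
    (toWeakSpace 𝕜 X).toEquiv hrefl.isCompact_toWeakSpace_closedBall hconv.closure
    ((convexHull_nonempty_iff.2 hne).image _).closure hclosed
  refine ⟨u, hu, fun A hA => hfix A ?_
    (norm_apply_le_of_mem_convexHull hS (subset_convexHull ℝ 𝒮 hA))⟩
  refine MapsTo.closure ?_ A.continuous
  rintro _ ⟨T, hT, rfl⟩
  exact ⟨A.comp T, comp_mem_convexHull hmul (subset_convexHull ℝ 𝒮 hA) hT, rfl⟩

/-- A map `P` onto fixed points, with `P x` in the closed convex hull of the orbit of `x` and
constant along orbits, can be approximated on finite sets by the convex hull of the semigroup. -/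
theorem exists_mem_convexHull_forall_norm_sub_lt (hne : 𝒮.Nonempty)
    (hmul : ∀ A ∈ 𝒮, ∀ B ∈ 𝒮, A.comp B ∈ 𝒮) (hS : ∀ A ∈ 𝒮, ‖A‖ ≤ 1) {P : X → X}
    (hmem : ∀ x, P x ∈ closure ((fun T : X →L[𝕜] X => T x) '' convexHull ℝ 𝒮))
    (hfix : ∀ x, ∀ A ∈ 𝒮, A (P x) = P x) (hinv : ∀ T ∈ convexHull ℝ 𝒮, ∀ x, P (T x) = P x)
    {s : Set X} (hs : s.Finite) {ε : ℝ} (hε : 0 < ε) :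
    ∃ T ∈ convexHull ℝ 𝒮, ∀ x ∈ s, ‖T x - P x‖ < ε := by
  induction s, hs using Set.Finite.induction_on with
  | empty =>
    obtain ⟨T, hT⟩ := (convexHull_nonempty_iff (𝕜 := ℝ)).2 hne
    exact ⟨T, hT, by simp⟩
  | @insert x s _ _ ih =>
    obtain ⟨T, hT, hTs⟩ := ih
    obtain ⟨_, ⟨U, hU, rfl⟩, hUx⟩ := Metric.mem_closure_iff.1 (hmem (T x)) ε hε
    -- `U` handles the new point, as `P (T x) = P x`; being a contraction that fixes each `P y`, it
    -- does not spoil the earlier estimates.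
    refine ⟨U.comp T, comp_mem_convexHull hmul hU hT, ?_⟩
    rintro y (rfl | hy)
    · rwa [hinv T hT, dist_comm, dist_eq_norm] at hUx
    · have h : U.comp T y - P y = U (T y - P y) := by
        rw [map_sub, apply_eq_self_of_mem_convexHull (hfix y) hU]
        rfl
      rw [h]
      exact (norm_apply_le_of_mem_convexHull hS hU _).trans_lt (hTs y hy)

theorem mem_strongClosedConvexHull_of_forall_finite {P : X →L[𝕜] X}
    (h : ∀ s : Set X, s.Finite → ∀ ε > 0, ∃ T ∈ convexHull ℝ 𝒮, ∀ x ∈ s, ‖T x - P x‖ < ε) :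
    P ∈ strongClosedConvexHull 𝒮 := by
  refine (mem_closure_iff_nhds_basis
    (PointwiseConvergenceCLM.withSeminorms (σ := RingHom.id 𝕜) (E := X) (F := X)
      |>.hasBasis_ball)).2 ?_
  rintro ⟨s, ε⟩ hε
  obtain ⟨T, hT, hTs⟩ := h s s.finite_toSet ε hε
  refine ⟨_, ⟨T, hT, rfl⟩, ?_⟩
  exact (Seminorm.mem_ball _).2 (Seminorm.finset_sup_apply_lt hε hTs)

/-- Evaluation at `x` is strongly continuous, so closed pointwise conditions pass to the closure. -/
theorem apply_mem_of_mem_strongClosedConvexHull {C : Set X} (hC : IsClosed C) {x : X}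
    (h : ∀ T ∈ convexHull ℝ 𝒮, T x ∈ C) {T : X →L[𝕜] X} (hT : T ∈ strongClosedConvexHull 𝒮) :
    T x ∈ C := by
  have hclosed : IsClosed {V : X →Lₚₜ[𝕜] X | V x ∈ C} :=
    hC.preimage (PointwiseConvergenceCLM.evalCLM (RingHom.id 𝕜) X x).continuous
  refine closure_minimal ?_ hclosed hT
  rintro _ ⟨V, hV, rfl⟩
  exact h V hV

/-- A semigroup of contractions on a reflexive Banach space is mean ergodic if the closed unit balls
of the space and of its dual are strictly convex. -/
theorem isMeanErgodic_of_contractions (hrefl : IsReflexiveSpace 𝕜 X)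
    (hX : StrictConvex ℝ (closedBall (0 : X) 1))
    (hX' : StrictConvex ℝ (closedBall (0 : StrongDual 𝕜 X) 1)) (hne : 𝒮.Nonempty)
    (hmul : ∀ A ∈ 𝒮, ∀ B ∈ 𝒮, A.comp B ∈ 𝒮) (hS : ∀ A ∈ 𝒮, ‖A‖ ≤ 1) : IsMeanErgodic 𝒮 := by
  choose p hmem hfix using exists_fixed_mem_closure_orbit hrefl hX hne hmul hS
  have hdual : ∀ ψ : StrongDual 𝕜 X, (∀ A ∈ 𝒮, ψ.comp A = ψ) → ∀ x, ψ (p x) = ψ x := by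
    intro ψ hψ x
    refine closure_minimal (t := {v | ψ v = ψ x}) ?_
      (isClosed_eq ψ.continuous continuous_const) (hmem x)
    rintro _ ⟨T, hT, rfl⟩
    exact dual_apply_eq_of_mem_convexHull hψ hT x
  have huniq : ∀ u v, (∀ A ∈ 𝒮, A u = u) → (∀ A ∈ 𝒮, A v = v) →
      (∀ ψ : StrongDual 𝕜 X, (∀ A ∈ 𝒮, ψ.comp A = ψ) → ψ u = ψ v) → u = v := by
    intro u v hu hv h
    refine (SeparatingDual.eq_iff_forall_dual_eq (R := 𝕜)).2 fun φ => ?_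
    obtain ⟨ψ, hψ, hψφ⟩ := exists_invariant_dual_eqOn_fixed hX' hS φ
    rw [← hψφ u hu, ← hψφ v hv, h ψ hψ]
  have hnorm : ∀ x, ‖p x‖ ≤ 1 * ‖x‖ := by
    intro x
    rw [one_mul]
    refine closure_minimal (t := {v | ‖v‖ ≤ ‖x‖}) ?_
      (isClosed_le continuous_norm continuous_const) (hmem x)
    rintro _ ⟨T, hT, rfl⟩
    exact norm_apply_le_of_mem_convexHull hS hT x
  -- Both sides of each identity are fixed points on which invariant functionals agree.
  let L : X →ₗ[𝕜] X :=
    { toFun := p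
      map_add' := fun x y => huniq _ _ (hfix _)
        (fun A hA => by rw [map_add, hfix x A hA, hfix y A hA])
        (fun ψ hψ => by simp only [map_add, hdual ψ hψ])
      map_smul' := fun c x => huniq _ _ (hfix _)
        (fun A hA => by rw [RingHom.id_apply, map_smul, hfix x A hA])
        (fun ψ hψ => by simp only [RingHom.id_apply, map_smul, hdual ψ hψ]) }
  have hinv : ∀ T ∈ convexHull ℝ 𝒮, ∀ x, p (T x) = p x := fun T hT x =>
    huniq _ _ (hfix _) (hfix _) fun ψ hψ => by
      rw [hdual ψ hψ, hdual ψ hψ, dual_apply_eq_of_mem_convexHull hψ hT]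
  let P : X →L[𝕜] X := L.mkContinuous 1 hnorm
  refine ⟨P, mem_strongClosedConvexHull_of_forall_finite fun s hs ε hε =>
    exists_mem_convexHull_forall_norm_sub_lt hne hmul hS hmem hfix hinv hs hε, ?_⟩
  intro T hT
  constructor
  · ext x
    exact apply_mem_of_mem_strongClosedConvexHull (C := {v | P v = P x})
      (isClosed_eq P.continuous continuous_const) (fun V hV => hinv V hV x) hT
  · ext x
    -- Here the evaluation point is `P x`, not `x`.
    exact apply_mem_of_mem_strongClosedConvexHull (C := {P x}) isClosed_singleton
      (fun V hV => apply_eq_self_of_mem_convexHull (hfix x) hV) hT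

end Operators

theorem corollary1p10 {𝕜 : Type*} [RCLike 𝕜] {X : Type*} [NormedAddCommGroup X]
    [NormedSpace 𝕜 X] [NormedSpace ℝ X] [IsScalarTower ℝ 𝕜 X] [CompleteSpace X]
    (hrefl : IsReflexiveSpace 𝕜 X)
    (hX : StrictConvex ℝ (Metric.closedBall (0 : X) 1))
    (hX' : StrictConvex ℝ (Metric.closedBall (0 : StrongDual 𝕜 X) 1))
    {G : Type*} [Semigroup G] [Nonempty G] [TopologicalSpace G] [SeparatelyContinuousMul G]
    (S : BoundedRepresentation 𝕜 G X) (hS : ∀ g, ‖S.toFun g‖ ≤ 1) :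
    IsMeanErgodic S.operators := by
  refine isMeanErgodic_of_contractions hrefl hX hX' (range_nonempty S.toFun) ?_ ?_
  · rintro _ ⟨g, rfl⟩ _ ⟨h, rfl⟩
    exact ⟨h * g, (S.comp' g h).symm⟩
  · rintro _ ⟨g, rfl⟩
    exact hS g
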